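/- Let $n\ge 1$ and let $\Omega\subset\mathbb R^n$ be a bounded Lipschitz domain (open and connected) with polyhedral boundary. Let $\mathcal T$ be a regular triangulation of $\Omega$ into $n$-simplices, with set of sides $\mathcal E$, where $\mathcal E(T)$ denotes the set of sides of $T\in\mathcal T$; a side is a boundary side if it lies in $\partial\Omega$ and an interior side otherwise. Let $\nu_T$ be the outer unit normal along $\partial T$ and, for every $E\in\mathcal E$, let the unit normal $\nu_E$ be a fixed choice of $\nu_T|_E$ for one of the simplices $T\in\mathcal T$ with side $E$. Let $0<\gamma_1\le\gamma_2$ and let $\phi\in C([0,\infty))\cap C^2(0,\infty)$ satisfy $\gamma_1\le\phi(t)\le\gamma_2$ for all $t\ge0$ and $\gamma_1\le\phi(t)+t\phi'(t)\le\gamma_2$ for all $t>0$. Set $\sigma(A):=\phi(|A|)A$ for $A\in\mathbb R^n$, with Fréchet derivative $\mathrm D\sigma$, and let $f\in L^2(\Omega)$. Let $P_1(\mathcal T)$ be the space of functions that are affine on each $T\in\mathcal T$ (with no continuity across sides), with piecewise gradient $\nabla_{NC}$, and let $P_0(\mathcal E)$ be the space of functions on the skeleton $\partial\mathcal T=\bigcup\mathcal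 E$ that are constant on each side. Let $S^1_0(\mathcal T):=P_1(\mathcal T)\cap H^1_0(\Omega)$, and let $CR^1_0(\mathcal T)$ be the set of those $v\in P_1(\mathcal T)$ that are continuous at the barycenters of the interior sides and vanish at the barycenters of the boundary sides. For $v,w\in P_1(\mathcal T)$ and $t\in P_0(\mathcal E)$ set $$a(v,w):=\int_\Omega vw\,dx+\int_\Omega\nabla_{NC}v\cdot\nabla_{NC}w\,dx,\qquad \langle t,v\rangle_{\partial\mathcal T}:=\sum_{T\in\mathcal T}\sum_{E\in\mathcal E(T)}\int_E(\nu_T\cdot\nu_E)\,t\,v|_T\,ds .$$ The mixed system seeks $(u_h,t_h)\in S^1_0(\mathcal T)\times P_0(\mathcal E)$ and $v_h\in P_1(\mathcal T)$ with $$\begin{aligned} a(v_h,\eta_h)+\int_\Omega\sigma(\nabla u_h)\cdot\nabla_{NC}\eta_h\,dx-\langle t_h,\eta_h\rangle_{\partial\mathcal T}&=\int_\Omega f\eta_h\,dx&&\text{for all }\eta_h\in P_1(\mathcal T),\\ \int_\Omega\nabla w_h\cdot\big(\mathrm D\sigma(\nabla u_h)\nabla_{NC}v_h\big)\,dx-\langle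 s_h,v_h\rangle_{\partial\mathcal T}&=0&&\text{for all }(w_h,s_h)\in S^1_0(\mathcal T)\times P_0(\mathcal E).\end{aligned}\tag{M}$$ The reduced system seeks $(u_h,v_h)\in S^1_0(\mathcal T)\times CR^1_0(\mathcal T)$ with $$\begin{aligned} a(v_h,w_{CR})+\int_\Omega\sigma(\nabla u_h)\cdot\nabla_{NC}w_{CR}\,dx&=\int_\Omega fw_{CR}\,dx&&\text{for all }w_{CR}\in CR^1_0(\mathcal T),\\ \int_\Omega\nabla w_C\cdot\big(\mathrm D\sigma(\nabla u_h)\nabla_{NC}v_h\big)\,dx&=0&&\text{for all }w_C\in S^1_0(\mathcal T).\end{aligned}\tag{R}$$ (a) If $(u_h,t_h;v_h)\in S^1_0(\mathcal T)\times P_0(\mathcal E)\times P_1(\mathcal T)$ solves (M), then $v_h\in CR^1_0(\mathcal T)$ and $(u_h,v_h)$ solves (R). (b) For any solution $(u_h,v_h)\in S^1_0(\mathcal T)\times CR^1_0(\mathcal T)$ of (R) there exists a unique $t_h\in P_0(\mathcal E)$ such that $(u_h,t_h;v_h)$ solves (M). -/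

import Mathlib

open MeasureTheory Filter Topology
open scoped ContDiff

noncomputable section

namespace DPG

/-- Euclidean space `ℝⁿ`. -/
abbrev Pt (n : ℕ) : Type := EuclideanSpace ℝ (Fin n)

/-! ### The domain -/

/-- A bounded Lipschitz domain: a bounded, nonempty, connected, open set which, in a neighbourhood
of each of its boundary points, is the strict epigraph of a Lipschitz function over a hyperplane
`e^⊥`. -/
structure IsLipschitzDomain {n : ℕ} (Ω : Set (Pt n)) : Prop where
  isOpen : IsOpen Ω
  isConnected : IsConnected Ω
  isBounded : Bornology.IsBounded Ω
  local_graph : ∀ x ∈ frontier Ω, ∃ (e : Pt n) (r : ℝ) (L : NNReal)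
    (g : (Submodule.span ℝ {e})ᗮ → ℝ), ‖e‖ = 1 ∧ 0 < r ∧ LipschitzWith L g ∧
      ∀ y ∈ Metric.ball x r,
        (y ∈ Ω ↔ g ((Submodule.span ℝ {e})ᗮ.orthogonalProjectionOnto y) < inner ℝ e y)

/-! ### Triangulations -/

/-- A regular triangulation of `Ω` into `n`-simplices: a finite simplicial complex (any two
simplices meet in the convex hull of their common vertices) that covers the closure of `Ω` and all
of whose faces are faces of `n`-simplices. A simplex is given by the finite set of its vertices. -/
structure Triangulation {n : ℕ} (Ω : Set (Pt n)) extends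
    Geometry.SimplicialComplex ℝ (Pt n) where
  finite_faces : faces.Finite
  pure_faces : ∀ s ∈ faces, ∃ t ∈ faces, s ⊆ t ∧ t.card = n + 1
  space_eq : toSimplicialComplex.space = closure Ω

variable {n : ℕ} {Ω : Set (Pt n)}

namespace Triangulation

/-- The `n`-simplices `T` of the triangulation. -/
def cells (𝒯 : Triangulation Ω) : Finset (Finset (Pt n)) :=
  𝒯.finite_faces.toFinset.filter (fun s => s.card = n + 1)

/-- The sides `E` of the triangulation, i.e. its `(n-1)`-simplices. -/
def sides (𝒯 : Triangulation Ω) : Finset (Finset (Pt n)) :=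
  𝒯.finite_faces.toFinset.filter (fun s => s.card = n)

/-- The type of the `n`-simplices. -/
abbrev Cell (𝒯 : Triangulation Ω) : Type := {T : Finset (Pt n) // T ∈ 𝒯.cells}

/-- The type of the sides. -/
abbrev Side (𝒯 : Triangulation Ω) : Type := {E : Finset (Pt n) // E ∈ 𝒯.sides}

end Triangulation

/-- The closed simplex with the given vertices. -/
def hull (s : Finset (Pt n)) : Set (Pt n) := convexHull ℝ (s : Set (Pt n))

/-- The barycenter of the simplex with the given vertices. -/
def mid (s : Finset (Pt n)) : Pt n := s.centroid ℝ id

open Classical in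
/-- The sides `E(T)` of the simplex `T`. -/
def Triangulation.sidesOf (𝒯 : Triangulation Ω) (T : 𝒯.Cell) : Finset 𝒯.Side :=
  Finset.univ.filter (fun E => E.1 ⊆ T.1)

/-- `E` belongs to `E(∂Ω)`: the side lies on the boundary of `Ω`. -/
def Triangulation.IsBoundarySide (𝒯 : Triangulation Ω) (E : 𝒯.Side) : Prop :=
  hull E.1 ⊆ frontier Ω

/-- `E` belongs to `E(Ω)`: the side is interior. -/
def Triangulation.IsInteriorSide (𝒯 : Triangulation Ω) (E : 𝒯.Side) : Prop :=
  ¬ 𝒯.IsBoundarySide E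

/-- The unit normal `ν_T` along the side `E` of `T` that points out of `T`: the normalized
component, orthogonal to `E`, of the vector from the barycenter of `T` to the one of `E`. -/
def outerNormal (T E : Finset (Pt n)) : Pt n :=
  let w : Pt n := (vectorSpan ℝ (E : Set (Pt n)))ᗮ.starProjection (mid E - mid T)
  ‖w‖⁻¹ • w

/-- A global choice of unit normals `ν_E` of the sides: each `ν_E` is the outer unit normal of one
of the (one or two) simplices that have `E` as a side. -/
def Triangulation.IsOrientation (𝒯 : Triangulation Ω) (ν : 𝒯.Side → Pt n) : Prop :=
  ∀ E : 𝒯.Side, ∃ T : 𝒯.Cell, E ∈ 𝒯.sidesOf T ∧ ν E = outerNormal T.1 E.1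

/-! ### Discrete spaces -/

/-- `P_1(𝒯)`: one affine function for each `T ∈ 𝒯` (no continuity across the sides). -/
abbrev P1 (𝒯 : Triangulation Ω) : Type := 𝒯.Cell → (Pt n →ᵃ[ℝ] ℝ)

/-- `P_0(ℰ)`: functions on the skeleton that are constant on each side. -/
abbrev P0Sides (𝒯 : Triangulation Ω) : Type := 𝒯.Side → ℝ

variable {𝒯 : Triangulation Ω}

open Classical in
/-- The piecewise affine function `v` as a function on `ℝⁿ`, equal to `v|_T` in the interior of
each `T ∈ 𝒯` (and to zero on the null set of skeleton points, and outside of the closure of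
`Ω`). -/
def P1.toFun (v : P1 𝒯) (x : Pt n) : ℝ :=
  ∑ T : 𝒯.Cell, (interior (hull T.1)).indicator (fun y => v T y) x

open Classical in
/-- The piecewise gradient `∇_NC v`, equal to `∇(v|_T)` in the interior of each `T ∈ 𝒯`. For
functions in `H¹(Ω)` it is the weak gradient almost everywhere. -/
def P1.gradNC (v : P1 𝒯) (x : Pt n) : Pt n :=
  ∑ T : 𝒯.Cell, (interior (hull T.1)).indicator (fun y => gradient (fun z => v T z) y) x

/-- Membership in `H¹_0(Ω)`, the closure of the smooth functions with compact support in `Ω` with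
respect to the norm of `H¹(Ω)`. -/
def MemH10 (Ω : Set (Pt n)) (u : Pt n → ℝ) : Prop :=
  MemLp u 2 (volume.restrict Ω) ∧
  ∃ g : Pt n → Pt n, MemLp g 2 (volume.restrict Ω) ∧
  ∃ ψ : ℕ → Pt n → ℝ,
    (∀ k, ContDiff ℝ ∞ (ψ k) ∧ HasCompactSupport (ψ k) ∧ tsupport (ψ k) ⊆ Ω) ∧
    Tendsto (fun k => eLpNorm (fun x => ψ k x - u x) 2 (volume.restrict Ω)) atTop (𝓝 0) ∧
    Tendsto (fun k => eLpNorm (fun x => gradient (ψ k) x - g x) 2 (volume.restrict Ω))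
      atTop (𝓝 0)

/-- `S¹_0(𝒯) = P_1(𝒯) ∩ H¹_0(Ω)`. -/
def S10 (𝒯 : Triangulation Ω) : Set (P1 𝒯) :=
  {v | MemH10 Ω v.toFun}

/-- `CR¹(𝒯)`: piecewise affine functions that are continuous at the barycenters of the interior
sides. -/
def CR1 (𝒯 : Triangulation Ω) : Set (P1 𝒯) :=
  {v | ∀ E : 𝒯.Side, 𝒯.IsInteriorSide E →
    ∀ T T' : 𝒯.Cell, E ∈ 𝒯.sidesOf T → E ∈ 𝒯.sidesOf T' → v T (mid E.1) = v T' (mid E.1)}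

/-- `CR¹_0(𝒯)`: functions in `CR¹(𝒯)` that vanish at the barycenters of the boundary sides. -/
def CR10 (𝒯 : Triangulation Ω) : Set (P1 𝒯) :=
  {v | v ∈ CR1 𝒯 ∧ ∀ E : 𝒯.Side, 𝒯.IsBoundarySide E →
    ∀ T : 𝒯.Cell, E ∈ 𝒯.sidesOf T → v T (mid E.1) = 0}

/-! ### The forms of the discretization -/

/-- The stress `σ(A) = φ(|A|) A`. -/
def sigma (φ : ℝ → ℝ) (A : Pt n) : Pt n := φ ‖A‖ • A

/-- The scalar product of `H¹(𝒯)`: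
`a(v, w) = ∫_Ω v w dx + ∫_Ω ∇_NC v · ∇_NC w dx`. -/
def aForm (v w : P1 𝒯) : ℝ :=
  (∫ x in Ω, v.toFun x * w.toFun x) + ∫ x in Ω, inner ℝ (v.gradNC x) (w.gradNC x)

/-- The local trace `t_T` on the side `E` of `T` of a piecewise constant function `t` on the
skeleton: `t_T = (ν_T · ν_E) t` on `E`. -/
def localTrace (ν : 𝒯.Side → Pt n) (t : P0Sides 𝒯) (T : 𝒯.Cell) (E : 𝒯.Side) : ℝ :=
  inner ℝ (outerNormal T.1 E.1) (ν E) * t E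

/-- The duality bracket on the skeleton, `⟨t, v⟩_{∂𝒯} = ∑_T ∫_{∂T} t_T v|_T ds`, where `ds` is the
`(n-1)`-dimensional surface measure. -/
def bracket (ν : 𝒯.Side → Pt n) (t : P0Sides 𝒯) (v : P1 𝒯) : ℝ :=
  ∑ T : 𝒯.Cell, ∑ E ∈ 𝒯.sidesOf T,
    ∫ x in hull E.1, localTrace ν t T E * v T x ∂(μHE[n - 1] : Measure (Pt n))

/-- `b(u, t; v) = ∫_Ω σ(∇u) · ∇_NC v dx - ⟨t, v⟩_{∂𝒯}`. -/
def bForm (φ : ℝ → ℝ) (ν : 𝒯.Side → Pt n) (u : P1 𝒯) (t : P0Sides 𝒯) (v : P1 𝒯) : ℝ :=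
  (∫ x in Ω, inner ℝ (sigma φ (u.gradNC x)) (v.gradNC x)) - bracket ν t v

/-- `c(u; w, v) = ∫_Ω ∇w · (Dσ(∇u) ∇_NC v) dx` with the Fréchet derivative `Dσ` of `σ`. -/
def dsigmaForm (φ : ℝ → ℝ) (u w v : P1 𝒯) : ℝ :=
  ∫ x in Ω, inner ℝ (w.gradNC x) (fderiv ℝ (sigma φ) (u.gradNC x) (v.gradNC x))

/-- `b'(u, t; w, s, v) = ∫_Ω ∇w · (Dσ(∇u) ∇_NC v) dx - ⟨s, v⟩_{∂𝒯}`, which does not depend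
on `t`. -/
def bDeriv (φ : ℝ → ℝ) (ν : 𝒯.Side → Pt n) (u : P1 𝒯) (_t : P0Sides 𝒯)
    (w : P1 𝒯) (s : P0Sides 𝒯) (v : P1 𝒯) : ℝ :=
  dsigmaForm φ u w v - bracket ν s v

/-- `F(v) = ∫_Ω f v dx`. -/
def load (f : Pt n → ℝ) (v : P1 𝒯) : ℝ := ∫ x in Ω, f x * v.toFun x

/-- `(u_h, t_h; v_h) ∈ X_h × Y_h = S¹_0(𝒯) × P_0(ℰ) × P_1(𝒯)` solves the mixed system. -/
def SolvesMixed (φ : ℝ → ℝ) (f : Pt n → ℝ) (ν : 𝒯.Side → Pt n)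
    (u : P1 𝒯) (t : P0Sides 𝒯) (v : P1 𝒯) : Prop :=
  u ∈ S10 𝒯 ∧
  (∀ η : P1 𝒯, aForm v η + bForm φ ν u t η = load f η) ∧
  (∀ w ∈ S10 𝒯, ∀ s : P0Sides 𝒯, bDeriv φ ν u t w s v = 0)

/-- `(u_h, v_h) ∈ S¹_0(𝒯) × CR¹_0(𝒯)` solves the reduced system. -/
def SolvesReduced (φ : ℝ → ℝ) (f : Pt n → ℝ) (u v : P1 𝒯) : Prop :=
  u ∈ S10 𝒯 ∧ v ∈ CR10 𝒯 ∧
  (∀ w ∈ CR10 𝒯,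
    aForm v w + (∫ x in Ω, inner ℝ (sigma φ (u.gradNC x)) (w.gradNC x)) = load f w) ∧
  (∀ w ∈ S10 𝒯, dsigmaForm φ u w v = 0)

end DPG

end

/-! The whole argument is duality in the finite-dimensional space `P1 𝒯`, with `u` and `v` frozen.
An affine function integrates over a side `E` to the measure of `E` times its value at the midpoint
(`exists_integral_side`). Hence `bracket ν t v` equals `∑ E, t E * c E * jump ν E v` with `c E > 0`
(`exists_bracket_eq_sum_jump`).

The geometric input is that an interior side belongs to exactly two cells, with opposite outer
normals, and a boundary side to only one. So `jump ν E v` is a difference of two midpoint traces or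
a single trace, and `CR10 𝒯` is the common kernel of the jumps (`mem_CR10_iff_jump`).

For (a), testing the second equation with `w = 0` and the indicator of one side makes each jump of
`v` vanish; the bracket then disappears for nonconforming test functions. For (b), the residual of
the first equation is linear in the test function (`isLinearMap_residual`) and vanishes on the
common kernel of finitely many functionals, so it is a combination `∑ d E * jump ν E`; `t E = d E /
c E` is the multiplier. It is unique because the jumps have a dual basis (`exists_jump_eq_single`).
-/

noncomputable section

namespace DPG

/-! ### Affine functions on a simplex -/

lemma affineMap_sum_smul {V ι : Type*} [AddCommGroup V] [Module ℝ V] (A : V →ᵃ[ℝ] ℝ)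
    (s : Finset ι) (w : ι → ℝ) (p : ι → V) (hw : ∑ i ∈ s, w i = 1) :
    A (∑ i ∈ s, w i • p i) = ∑ i ∈ s, w i * A (p i) := by
  rw [← Finset.affineCombination_eq_linear_combination s p w hw, Finset.map_affineCombination _ _ _ hw,
    Finset.affineCombination_eq_linear_combination s _ w hw]
  simp

lemma sum_inv_card {ι : Type*} {s : Finset ι} (hs : s.Nonempty) :
    ∑ _i ∈ s, (s.card : ℝ)⁻¹ = 1 := by
  have : (s.card : ℝ) ≠ 0 := by exact_mod_cast hs.card_pos.ne'
  simp [this]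

lemma mid_eq_sum {n : ℕ} {E : Finset (Pt n)} (hE : E.Nonempty) :
    mid E = ∑ p ∈ E, (E.card : ℝ)⁻¹ • p := by
  rw [mid, Finset.centroid, Finset.affineCombination_eq_linear_combination]
  · simp [Finset.centroidWeights_apply]
  · simpa [Finset.centroidWeights_apply] using sum_inv_card hE

lemma affineMap_mid {n : ℕ} {E : Finset (Pt n)} (hE : E.Nonempty) (A : Pt n →ᵃ[ℝ] ℝ) :
    A (mid E) = (E.card : ℝ)⁻¹ * ∑ p ∈ E, A p := by
  rw [mid_eq_sum hE, affineMap_sum_smul _ _ _ _ (sum_inv_card hE), Finset.mul_sum]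

/-- The relative interior of the simplex with vertices `E`. -/
def relInt {n : ℕ} (E : Finset (Pt n)) : Set (Pt n) :=
  {x | ∃ w : Pt n → ℝ, (∀ p ∈ E, 0 < w p) ∧ ∑ p ∈ E, w p = 1 ∧ ∑ p ∈ E, w p • p = x}

lemma mid_mem_relInt {n : ℕ} {E : Finset (Pt n)} (hE : E.Nonempty) : mid E ∈ relInt E :=
  ⟨fun _ => (E.card : ℝ)⁻¹, fun _ _ => by have := hE.card_pos; positivity,
    sum_inv_card hE, (mid_eq_sum hE).symm⟩

lemma relInt_subset_hull {n : ℕ} (E : Finset (Pt n)) : relInt E ⊆ hull E := by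
  rintro x ⟨w, hw, h1, rfl⟩
  exact Finset.mem_convexHull'.2 ⟨w, fun p hp => (hw p hp).le, h1, rfl⟩

/-- Barycentric coordinates of an `n`-simplex in `ℝⁿ`. -/
lemma exists_coords {n : ℕ} {T : Finset (Pt n)} (hT : AffineIndependent ℝ ((↑) : T → Pt n))
    (hc : T.card = n + 1) :
    ∃ c : Pt n → (Pt n →ᵃ[ℝ] ℝ),
      (∀ p ∈ T, c p p = 1) ∧ (∀ p ∈ T, ∀ q ∈ T, q ≠ p → c p q = 0) ∧
      (∀ x, ∑ p ∈ T, c p x = 1) ∧ (∀ x, ∑ p ∈ T, c p x • p = x) ∧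
      hull T = {x | ∀ p ∈ T, 0 ≤ c p x} := by
  classical
  have htop : affineSpan ℝ (Set.range ((↑) : T → Pt n)) = ⊤ := by
    rw [hT.affineSpan_eq_top_iff_card_eq_finrank_add_one]
    simp [hc]
  let b : AffineBasis T ℝ (Pt n) := ⟨_, hT, htop⟩
  have hb : ∀ i, b i = i := fun i => rfl
  have hr : Set.range b = T := by
    change Set.range ((↑) : T → Pt n) = T
    simp
  -- Indexing by points avoids subtypes; the value 0 for points outside `T` never enters the claims.
  refine ⟨fun p => if h : p ∈ T then b.coord ⟨p, h⟩ else 0, ?_, ?_, ?_, ?_, ?_⟩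
  · intro p hp
    simp only [hp, dif_pos]
    exact b.coord_apply_eq ⟨p, hp⟩
  · intro p hp q hq hqp
    simp only [hp, dif_pos]
    exact b.coord_apply_ne (i := ⟨p, hp⟩) (j := ⟨q, hq⟩) (fun h => hqp (congrArg Subtype.val h).symm)
  · intro x
    rw [← Finset.sum_coe_sort, ← b.sum_coord_apply_eq_one x]
    simp
  · intro x
    rw [← Finset.sum_coe_sort]
    conv_rhs => rw [← b.linear_combination_coord_eq_self x]
    simp [hb]
  · ext x
    rw [hull, ← hr, b.convexHull_eq_nonneg_coord]
    simp only [Set.mem_ofPred_eq, Subtype.forall]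
    exact forall₂_congr fun p hp => by simp [hp]

lemma exists_eq_insert {n : ℕ} [DecidableEq (Pt n)] {T E : Finset (Pt n)} (hET : E ⊆ T)
    (hc : T.card = n + 1) (hE : E.card = n) : ∃ p, p ∉ E ∧ T = insert p E := by
  have := Finset.card_sdiff_of_subset hET
  obtain ⟨p, hp⟩ := Finset.card_eq_one.1 (show (T \ E).card = 1 by omega)
  refine ⟨p, fun h => ?_, ?_⟩
  · have : p ∈ T \ E := by simp [hp]
    exact (Finset.mem_sdiff.1 this).2 h
  · rw [← Finset.sdiff_union_of_subset hET, hp, Finset.insert_eq]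

/-- The relative height above the side `E` of `T`, as a linear functional: near the relative
interior of `E`, the simplex `T` is a half space. -/
lemma exists_height {n : ℕ} (hn : 1 ≤ n) {T E : Finset (Pt n)}
    (hT : AffineIndependent ℝ ((↑) : T → Pt n)) (hc : T.card = n + 1) (hET : E ⊆ T)
    (hE : E.card = n) :
    ∃ l : Pt n →ₗ[ℝ] ℝ, (∀ v ∈ vectorSpan ℝ (E : Set (Pt n)), l v = 0) ∧
      l (mid E - mid T) < 0 ∧
      ∀ x ∈ relInt E, ∀ᶠ y in 𝓝 x, (y ∈ hull T ↔ 0 ≤ l (y - x)) := by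
  classical
  obtain ⟨c, c1, c0, -, -, hull_eq⟩ := exists_coords hT hc
  obtain ⟨p, hpE, rfl⟩ := exists_eq_insert hET hc hE
  have hpT : p ∈ insert p E := Finset.mem_insert_self p E
  have hEn : E.Nonempty := Finset.card_pos.1 (by omega)
  have hcE : ∀ q ∈ E, c p q = 0 := fun q hq =>
    c0 p hpT q (hET hq) (fun h => hpE (h ▸ hq))
  have hsub : ∀ x y : Pt n, (c p).linear (y - x) = c p y - c p x := fun x y => by
    simpa using (c p).linearMap_vsub y x
  -- `c p` is the barycentric coordinate of the vertex opposite to `E`. It is 0 on `E` and `1 / (n +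
  -- 1)` at `mid T`. Near the relative interior of `E` all other coordinates are positive, so `0 ≤ c
  -- p` is the only active constraint of the simplex.
  refine ⟨(c p).linear, ?_, ?_, ?_⟩
  · suffices h : vectorSpan ℝ (E : Set (Pt n)) ≤ LinearMap.ker (c p).linear from
      fun v hv => h hv
    refine Submodule.span_le.2 ?_
    rintro _ ⟨x, hx, y, hy, rfl⟩
    have := hsub y x
    rw [hcE x hx, hcE y hy, sub_zero] at this
    exact this
  · rw [hsub, affineMap_mid hEn, affineMap_mid ⟨p, hpT⟩, Finset.sum_eq_zero hcE,
      Finset.sum_insert hpE, Finset.sum_eq_zero hcE, c1 p hpT, hc]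
    have : (0 : ℝ) < ((n + 1 : ℕ) : ℝ)⁻¹ := by positivity
    linarith
  · rintro x ⟨w, hw, hw1, rfl⟩
    have hcx : ∀ q ∈ insert p E, c q (∑ r ∈ E, w r • r) = ∑ r ∈ E, w r * c q r := fun q _ =>
      affineMap_sum_smul _ _ _ _ hw1
    have hp0 : c p (∑ r ∈ E, w r • r) = 0 := by
      rw [hcx p hpT]
      exact Finset.sum_eq_zero fun r hr => by rw [hcE r hr, mul_zero]
    have hq0 : ∀ q ∈ E, 0 < c q (∑ r ∈ E, w r • r) := by
      intro q hq
      rw [hcx q (hET hq), Finset.sum_eq_single_of_mem q hq, c1 q (hET hq), mul_one]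
      · exact hw q hq
      · intro r hr hrq
        rw [c0 q (hET hq) r (hET hr) hrq, mul_zero]
    have hev : ∀ᶠ y in 𝓝 (∑ r ∈ E, w r • r), ∀ q ∈ E, 0 < c q y := by
      rw [Filter.eventually_all_finset]
      intro q hq
      exact (c q).continuous_of_finiteDimensional.continuousAt.eventually (lt_mem_nhds (hq0 q hq))
    filter_upwards [hev] with y hy
    rw [hull_eq, hsub, hp0, sub_zero]
    simp only [Finset.mem_insert, forall_eq_or_imp, Set.mem_ofPred_eq]
    exact ⟨fun h => h.1, fun h => ⟨h, fun q hq => (hy q hq).le⟩⟩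

/-- The nodal basis of the midpoints of the sides of a simplex. -/
lemma exists_affine_mid_eq_one {n : ℕ} (hn : 1 ≤ n) {T E : Finset (Pt n)}
    (hT : AffineIndependent ℝ ((↑) : T → Pt n)) (hc : T.card = n + 1) (hET : E ⊆ T)
    (hE : E.card = n) :
    ∃ A : Pt n →ᵃ[ℝ] ℝ, A (mid E) = 1 ∧
      ∀ F ⊆ T, F.card = n → F ≠ E → A (mid F) = 0 := by
  classical
  obtain ⟨c, c1, c0, -⟩ := exists_coords hT hc
  obtain ⟨p, hpE, rfl⟩ := exists_eq_insert hET hc hE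
  have hpT : p ∈ insert p E := Finset.mem_insert_self p E
  have hn0 : (n : ℝ) ≠ 0 := by positivity
  -- `c p` vanishes on `E`, while every other side contains `p` and so has `c p = 1 / n` at its
  -- midpoint.
  refine ⟨AffineMap.const ℝ _ 1 - (n : ℝ) • c p, ?_, ?_⟩
  · have hEn : E.Nonempty := Finset.card_pos.1 (by omega)
    have : c p (mid E) = 0 := by
      rw [affineMap_mid hEn, Finset.sum_eq_zero, mul_zero]
      exact fun q hq => c0 p hpT q (hET hq) (fun h => hpE (h ▸ hq))
    simp [this]
  · intro F hF hFc hFE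
    have hFn : F.Nonempty := Finset.card_pos.1 (by omega)
    have hpF : p ∈ F := by
      by_contra h
      refine hFE (Finset.eq_of_subset_of_card_le (fun q hq => ?_) (by omega))
      rcases Finset.mem_insert.1 (hF hq) with rfl | h'
      · exact absurd hq h
      · exact h'
    have : c p (mid F) = (n : ℝ)⁻¹ := by
      rw [affineMap_mid hFn, hFc, Finset.sum_eq_single_of_mem p hpF, c1 p hpT, mul_one]
      exact fun q hq hqp => c0 p hpT q (hF hq) hqp
    simp [this, hn0]

/-- A face of a simplex that meets the relative interior of another face contains it. -/
lemma subset_of_relInt_of_mem_hull {n : ℕ} {T E F : Finset (Pt n)}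
    (hT : AffineIndependent ℝ ((↑) : T → Pt n)) (hc : T.card = n + 1) (hET : E ⊆ T) (hFE : F ⊆ E)
    {x : Pt n} (hx : x ∈ relInt E) (hxF : x ∈ hull F) : E ⊆ F := by
  classical
  obtain ⟨c, c1, c0, -⟩ := exists_coords hT hc
  intro q hq
  by_contra hqF
  obtain ⟨w, hw, hw1, rfl⟩ := hx
  obtain ⟨w', -, hw1', h⟩ := Finset.mem_convexHull'.1 hxF
  -- The coordinate of a vertex `q` missing from `F` is positive when read off from `E`, but zero
  -- when read off from `F`.
  have h1 : c q (∑ p ∈ E, w p • p) = w q := by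
    rw [affineMap_sum_smul _ _ _ _ hw1, Finset.sum_eq_single_of_mem q hq, c1 q (hET hq), mul_one]
    intro r hr hrq
    rw [c0 q (hET hq) r (hET hr) hrq, mul_zero]
  have h2 : c q (∑ p ∈ F, w' p • p) = 0 := by
    rw [affineMap_sum_smul _ _ _ _ hw1']
    refine Finset.sum_eq_zero fun r hr => ?_
    rw [c0 q (hET hq) r (hET (hFE hr)) (fun h => hqF (h ▸ hr)), mul_zero]
  rw [h, h1] at h2
  exact (hw q hq).ne' h2

/-- The relative interior is dense in the simplex. -/
lemma hull_subset_closure_relInt {n : ℕ} {E : Finset (Pt n)} (hE : E.Nonempty) :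
    hull E ⊆ closure (relInt E) := by
  intro x hx
  obtain ⟨w, hw, hw1, rfl⟩ := Finset.mem_convexHull'.1 hx
  set x := ∑ p ∈ E, w p • p with hxdef
  -- Moving slightly towards the barycenter makes all weights positive.
  have hlim : Tendsto (fun ε : ℝ => (1 - ε) • x + ε • mid E) (𝓝[>] 0) (𝓝 x) := by
    have : Continuous (fun ε : ℝ => (1 - ε) • x + ε • mid E) := by fun_prop
    simpa using (this.tendsto 0).mono_left nhdsWithin_le_nhds
  refine mem_closure_of_tendsto hlim ?_
  filter_upwards [Ioo_mem_nhdsGT (show (0 : ℝ) < 1 by norm_num)] with ε hε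
  have hcard : (0 : ℝ) < (E.card : ℝ)⁻¹ := by have := hE.card_pos; positivity
  refine ⟨fun p => (1 - ε) * w p + ε * (E.card : ℝ)⁻¹, fun p hp => ?_, ?_, ?_⟩
  · have := mul_nonneg (sub_nonneg.2 hε.2.le) (hw p hp)
    have := mul_pos hε.1 hcard
    linarith
  · rw [Finset.sum_add_distrib, ← Finset.mul_sum, ← Finset.mul_sum, hw1, sum_inv_card hE]
    ring
  · rw [mid_eq_sum hE, hxdef, Finset.smul_sum, Finset.smul_sum, ← Finset.sum_add_distrib]
    exact Finset.sum_congr rfl fun p _ => by rw [add_smul, mul_smul, mul_smul]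

/-! ### The integral of an affine function over a simplex -/

/-- The value `-2` makes `d` change sign under the map, so the second step undoes the first. -/
lemma reflection_involutive {V : Type*} [AddCommGroup V] [Module ℝ V] (d : V →ᵃ[ℝ] ℝ) (w : V)
    (hw : d.linear w = -2) : Function.Involutive (fun x => x + d x • w) := by
  intro x
  have h : d (x + d x • w) = - d x := by
    have := d.map_vadd x (d x • w)
    simp only [vadd_eq_add, map_smul, hw, smul_eq_mul] at this
    rw [add_comm, this]; ring
  simp only [h]
  module

/-- Affine reflections, possibly skew, preserve the Lebesgue measure. -/
lemma measurePreserving_reflection {m : ℕ} (d : Pt m →ᵃ[ℝ] ℝ) (w : Pt m)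
    (hw : d.linear w = -2) :
    MeasurePreserving (fun x => x + d x • w) (volume : Measure (Pt m)) volume := by
  -- The map is `L` followed by a translation, and `L` is an involution, so its determinant is `±1`.
  let L : Pt m →ₗ[ℝ] Pt m := LinearMap.id + d.linear.smulRight w
  have hLL : L ∘ₗ L = LinearMap.id := by
    ext1 v
    simp only [L, LinearMap.comp_apply, LinearMap.add_apply, LinearMap.id_apply,
      LinearMap.smulRight_apply, map_add, map_smul, hw]
    module
  have hdet : LinearMap.det L * LinearMap.det L = 1 := by
    rw [← LinearMap.det_comp, hLL, LinearMap.det_id]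
  have hne : LinearMap.det L ≠ 0 := fun h => by simp [h] at hdet
  have habs : |(LinearMap.det L)⁻¹| = 1 := by
    rcases mul_self_eq_one_iff.1 hdet with h | h <;> simp [h]
  have hL : MeasurePreserving L (volume : Measure (Pt m)) volume :=
    ⟨L.continuous_of_finiteDimensional.measurable, by
      rw [Measure.map_linearMap_addHaar_eq_smul_addHaar _ hne, habs]; simp⟩
  have := (measurePreserving_add_right (volume : Measure (Pt m)) (d 0 • w)).comp hL
  convert! this using 1
  ext1 x
  have h := d.map_vadd 0 x
  simp only [vadd_eq_add, add_zero] at h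
  simp only [L, Function.comp_apply, LinearMap.add_apply, LinearMap.id_apply,
      LinearMap.smulRight_apply, h]
  module

lemma isCompact_hull {n : ℕ} (E : Finset (Pt n)) : IsCompact (hull E) :=
  E.finite_toSet.isCompact_convexHull (𝕜 := ℝ)

/-- For two vertices `p` and `q`, the skew reflection along `q - p` exchanges the coordinates `c p`
and `c q`, fixes the others and preserves volume. So all barycentric coordinates have the same
integral; as they sum to 1, each integral is the volume divided by the number of vertices. Expanding
`A` in these coordinates gives its mean over the vertices, which is its value at the barycenter. -/
lemma integral_hull_eq {m : ℕ} {T : Finset (Pt m)} (hT : AffineIndependent ℝ ((↑) : T → Pt m))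
    (hc : T.card = m + 1) (A : Pt m →ᵃ[ℝ] ℝ) :
    ∫ x in hull T, A x = (volume (hull T)).toReal * A (mid T) := by
  classical
  obtain ⟨c, c1, c0, csum, crep, hull_eq⟩ := exists_coords hT hc
  have hTn : T.Nonempty := Finset.card_pos.1 (by omega)
  have hint : ∀ B : Pt m →ᵃ[ℝ] ℝ, IntegrableOn B (hull T) := fun B =>
    B.continuous_of_finiteDimensional.continuousOn.integrableOn_compact (isCompact_hull T)
  have hswap : ∀ p ∈ T, ∀ q ∈ T, ∫ x in hull T, c p x = ∫ x in hull T, c q x := by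
    intro p hp q hq
    rcases eq_or_ne p q with rfl | hpq
    · rfl
    have hlin : ∀ r x y, (c r).linear (x - y) = c r x - c r y := fun r x y => by
      simpa using (c r).linearMap_vsub x y
    have hw : (c p - c q).linear (q - p) = -2 := by
      rw [AffineMap.sub_linear, LinearMap.sub_apply, hlin, hlin, c1 p hp, c1 q hq,
        c0 p hp q hq hpq.symm, c0 q hq p hp hpq]
      norm_num
    have hA : ∀ r x, c r (x + (c p - c q) x • (q - p)) =
        c r x + (c p x - c q x) * (c r q - c r p) := by
      intro r x
      have := (c r).map_vadd x ((c p - c q) x • (q - p))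
      simp only [vadd_eq_add, map_smul, hlin, smul_eq_mul] at this
      rw [add_comm, this]
      simp [add_comm]
    have hAp : ∀ x, c p (x + (c p - c q) x • (q - p)) = c q x := by
      intro x
      rw [hA, c1 p hp, c0 p hp q hq hpq.symm]; ring
    have hAq : ∀ x, c q (x + (c p - c q) x • (q - p)) = c p x := by
      intro x
      rw [hA, c1 q hq, c0 q hq p hp hpq]; ring
    have hAr : ∀ r ∈ T, r ≠ p → r ≠ q → ∀ x, c r (x + (c p - c q) x • (q - p)) = c r x := by
      intro r hr hrp hrq x
      rw [hA, c0 r hr q hq hrq.symm, c0 r hr p hp hrp.symm]; ring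
    have hmp := measurePreserving_reflection (c p - c q) (q - p) hw
    have hinv := reflection_involutive (c p - c q) (q - p) hw
    let e : Pt m ≃ᵐ Pt m := ⟨hinv.toPerm, hmp.measurable, hmp.measurable⟩
    have hpre : (fun x => x + (c p - c q) x • (q - p)) ⁻¹' hull T = hull T := by
      ext x
      rw [hull_eq]
      simp only [Set.mem_preimage, Set.mem_ofPred_eq]
      constructor
      · intro h r hr
        rcases eq_or_ne r p with rfl | hrp
        · simpa only [hAq] using h q hq
        rcases eq_or_ne r q with rfl | hrq
        · simpa only [hAp] using h p hp
        simpa only [hAr r hr hrp hrq] using h r hr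
      · intro h r hr
        rcases eq_or_ne r p with rfl | hrp
        · simpa only [hAp] using h q hq
        rcases eq_or_ne r q with rfl | hrq
        · simpa only [hAq] using h p hp
        simpa only [hAr r hr hrp hrq] using h r hr
    have := hmp.setIntegral_preimage_emb e.measurableEmbedding (c q) (hull T)
    rw [hpre] at this
    simpa only [hAq] using this
  have hone : ∑ p ∈ T, ∫ x in hull T, c p x = (volume (hull T)).toReal := by
    rw [← integral_finsetSum _ fun p _ => (hint (c p))]
    simp [csum, Measure.real]
  have hval : ∀ p ∈ T, ∫ x in hull T, c p x = (T.card : ℝ)⁻¹ * (volume (hull T)).toReal := by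
    intro p hp
    have : (T.card : ℝ) ≠ 0 := by exact_mod_cast hTn.card_pos.ne'
    rw [← hone, Finset.sum_congr rfl fun q hq => hswap q hq p hp]
    simp [this]
  have hrepA : ∀ x, A x = ∑ p ∈ T, c p x * A p := by
    intro x
    conv_lhs => rw [← crep x]
    exact affineMap_sum_smul A T (fun p => c p x) (fun p => p) (csum x)
  have : ∫ x in hull T, A x = ∫ x in hull T, ∑ p ∈ T, c p x * A p :=
    integral_congr_ae (ae_of_all _ hrepA)
  rw [this]
  rw [integral_finsetSum _ fun p _ => (hint (c p)).mul_const _,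
    Finset.sum_congr rfl fun p hp => (integral_mul_const (A p) _).trans (by rw [hval p hp]),
    ← Finset.mul_sum, affineMap_mid hTn]
  ring

lemma volume_hull_pos {m : ℕ} {T : Finset (Pt m)} (hT : AffineIndependent ℝ ((↑) : T → Pt m))
    (hc : T.card = m + 1) : 0 < volume (hull T) := by
  have : (interior (hull T)).Nonempty := by
    rw [hull, interior_convexHull_nonempty_iff_affineSpan_eq_top]
    have := hT.affineSpan_eq_top_iff_card_eq_finrank_add_one
    simp only [Subtype.range_coe_subtype, Finset.setOfPred_mem] at this
    exact this.2 (by simp [hc])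
  exact (isOpen_interior.measure_pos volume this).trans_le (measure_mono interior_subset)

/-- The integral of an affine function over a side is a multiple of its value at the midpoint. -/
lemma exists_integral_side {n : ℕ} (hn : 1 ≤ n) {E : Finset (Pt n)}
    (hE : AffineIndependent ℝ ((↑) : E → Pt n)) (hc : E.card = n) :
    ∃ c : ℝ, 0 < c ∧ ∀ A : Pt n →ᵃ[ℝ] ℝ,
      ∫ x in hull E, A x ∂(μHE[n - 1] : Measure (Pt n)) = c * A (mid E) := by
  classical
  obtain ⟨m, rfl⟩ : ∃ m, n = m + 1 := ⟨n - 1, by omega⟩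
  obtain ⟨p₀, hp₀⟩ : E.Nonempty := Finset.card_pos.1 (by omega)
  have hrank : Module.finrank ℝ (vectorSpan ℝ (E : Set (Pt (m + 1)))) = m := by
    have := hE.finrank_vectorSpan (n := m) (by simp [hc])
    rwa [show Set.range ((↑) : E → Pt (m + 1)) = E by simp] at this
  let e : Pt m ≃ₗᵢ[ℝ] vectorSpan ℝ (E : Set (Pt (m + 1))) :=
    ((stdOrthonormalBasis ℝ _).reindex (finCongr hrank)).repr.symm
  -- An isometric parametrization of the affine hull of `E`. It carries Lebesgue measure to the
  -- surface measure on its range, which reduces the claim to a full-dimensional simplex in `Pt m`.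
  let g : Pt m →ᵃⁱ[ℝ] Pt (m + 1) :=
    (AffineIsometryEquiv.vaddConst ℝ p₀).toAffineIsometry.comp
      ((vectorSpan ℝ (E : Set (Pt (m + 1)))).subtypeₗᵢ.comp e.toLinearIsometry).toAffineIsometry
  have hg : ∀ y, g y = e y + p₀ := fun y => rfl
  have hEg : (E : Set (Pt (m + 1))) ⊆ Set.range g := by
    intro p hp
    refine ⟨e.symm ⟨p - p₀, vsub_mem_vectorSpan ℝ hp hp₀⟩, ?_⟩
    rw [hg]
    simp
  let E' : Finset (Pt m) := E.preimage g g.injective.injOn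
  have hE'E : E'.image g = E := by
    rw [Finset.image_preimage]
    exact Finset.filter_true_of_mem hEg
  have hcard : E'.card = m + 1 := by
    rw [← hc, ← hE'E, Finset.card_image_of_injective _ g.injective]
  have hind : AffineIndependent ℝ ((↑) : E' → Pt m) := by
    refine AffineIndependent.of_comp g.toAffineMap ?_
    let emb : E' ↪ E := ⟨fun x => ⟨g x, Finset.mem_preimage.1 x.2⟩, fun x y h =>
      Subtype.ext (g.injective (congrArg Subtype.val h))⟩
    exact hE.comp_embedding emb
  have hhull : hull E = g '' hull E' := by
    have := g.toAffineMap.image_convexHull (E' : Set (Pt m))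
    rw [hull, hull, ← hE'E, Finset.coe_image]
    exact this.symm
  have hmid : ∀ A : Pt (m + 1) →ᵃ[ℝ] ℝ, A (mid E) = A (g (mid E')) := by
    intro A
    have h := affineMap_mid (Finset.card_pos.1 (by omega)) (A.comp g.toAffineMap) (E := E')
    rw [affineMap_mid ⟨p₀, hp₀⟩, hc, ← hE'E, Finset.sum_image g.injective.injOn]
    rw [hcard] at h
    exact h.symm
  have hemb : MeasurableEmbedding g := g.isometry.isClosedEmbedding.measurableEmbedding
  have hmap := g.isometry.map_euclideanHausdorffMeasure (d := m)
  rw [EuclideanSpace.euclideanHausdorffMeasure_eq_volume] at hmap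
  refine ⟨(volume (hull E')).toReal, ENNReal.toReal_pos (volume_hull_pos hind hcard).ne'
    (isCompact_hull E').measure_lt_top.ne, fun A => ?_⟩
  have hsub : hull E ⊆ Set.range g := hhull ▸ Set.image_subset_range _ _
  have h1 : (μHE[m + 1 - 1] : Measure (Pt (m + 1))).restrict (hull E) =
      (Measure.map g volume).restrict (hull E) := by
    rw [hmap, Measure.restrict_restrict_of_subset hsub]
    rfl
  rw [h1, hemb.setIntegral_map, hhull, Set.preimage_image_eq _ g.injective, hmid]
  exact integral_hull_eq hind hcard (A.comp g.toAffineMap)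

/-! ### The domain and its boundary -/

/-- This excludes slits, where a boundary side would have cells on both sides. From a boundary
point, a small step along `-e` goes strictly below the graph, where a whole neighbourhood misses
`Ω`; hence the point is not interior to the closure. -/
lemma IsLipschitzDomain.interior_closure_subset {n : ℕ} {Ω : Set (Pt n)}
    (hΩ : IsLipschitzDomain Ω) : interior (closure Ω) ⊆ Ω := by
  intro x hx
  by_contra hxΩ
  have hxf : x ∈ frontier Ω :=
    ⟨interior_subset hx, fun h => hxΩ (interior_subset h)⟩
  obtain ⟨e, r, L, g, he, hr, hg, hgraph⟩ := hΩ.local_graph x hxf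
  let G : Pt n → ℝ := fun y => g ((Submodule.span ℝ {e})ᗮ.orthogonalProjectionOnto y) - inner ℝ e y
  have hG : Continuous G :=
    (hg.continuous.comp (ContinuousLinearMap.continuous _)).sub (by fun_prop)
  have hGx : 0 ≤ G x := by
    have := (hgraph x (Metric.mem_ball_self hr)).not.1 hxΩ
    simp only [not_lt] at this
    exact sub_nonneg.2 this
  have hproj : (Submodule.span ℝ {e})ᗮ.orthogonalProjectionOnto e = 0 := by
    rw [Submodule.orthogonalProjectionOnto_eq_zero_iff]
    exact (Submodule.le_orthogonal_orthogonal _) (Submodule.mem_span_singleton_self e)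
  have hGt : ∀ t : ℝ, G (x - t • e) = G x + t := by
    intro t
    simp only [G, map_sub, map_smul, hproj, smul_zero, sub_zero, inner_sub_right,
      inner_smul_right, real_inner_self_eq_norm_sq, he]
    ring
  have hlim : Tendsto (fun t : ℝ => x - t • e) (𝓝[>] 0) (𝓝 x) := by
    have : Continuous (fun t : ℝ => x - t • e) := by fun_prop
    simpa using (this.tendsto 0).mono_left nhdsWithin_le_nhds
  have h1 := hlim.eventually (isOpen_interior.mem_nhds hx)
  have h2 := hlim.eventually (Metric.ball_mem_nhds x hr)
  obtain ⟨t, ht1, ht2, ht⟩ := (h1.and (h2.and self_mem_nhdsWithin)).exists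
  have hpos : 0 < G (x - t • e) := by
    rw [hGt]; exact add_pos_of_nonneg_of_pos hGx ht
  have hU : {y | 0 < G y} ∩ Metric.ball x r ∈ 𝓝 (x - t • e) :=
    ((isOpen_lt continuous_const hG).inter Metric.isOpen_ball).mem_nhds ⟨hpos, ht2⟩
  obtain ⟨y, ⟨hy1, hy2⟩, hyΩ⟩ := mem_closure_iff_nhds.1 (interior_subset ht1) _ hU
  have := (hgraph y hy2).1 hyΩ
  exact absurd hy1 (not_lt.2 (sub_nonpos.2 this.le))

/-! ### Cells and sides -/

/-- The vertices of `E` span a hyperplane, so the normal space is a line. -/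
lemma eq_or_eq_neg_of_mem_orthogonal {n : ℕ} (hn : 1 ≤ n) {E : Finset (Pt n)}
    (hE : AffineIndependent ℝ ((↑) : E → Pt n)) (hc : E.card = n) {a b : Pt n}
    (ha : a ∈ (vectorSpan ℝ (E : Set (Pt n)))ᗮ) (hb : b ∈ (vectorSpan ℝ (E : Set (Pt n)))ᗮ)
    (ha1 : ‖a‖ = 1) (hb1 : ‖b‖ = 1) :
    a = b ∨ a = -b := by
  have hrank : Module.finrank ℝ (vectorSpan ℝ (E : Set (Pt n))) = n - 1 := by
    have := hE.finrank_vectorSpan (n := n - 1) (by simp [hc]; omega)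
    rwa [show Set.range ((↑) : E → Pt n) = E by simp] at this
  have hrank' : Module.finrank ℝ (vectorSpan ℝ (E : Set (Pt n)))ᗮ = 1 := by
    have := (vectorSpan ℝ (E : Set (Pt n))).finrank_add_finrank_orthogonal
    rw [hrank, finrank_euclideanSpace_fin] at this
    omega
  have hb0 : (⟨b, hb⟩ : (vectorSpan ℝ (E : Set (Pt n)))ᗮ) ≠ 0 := by
    intro h
    have : b = 0 := congrArg Subtype.val h
    simp [this] at hb1
  obtain ⟨c, hcab⟩ := (finrank_eq_one_iff_of_nonzero' _ hb0).1 hrank' ⟨a, ha⟩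
  have hcab : c • b = a := congrArg Subtype.val hcab
  have : |c| = 1 := by rw [← ha1, ← hcab, norm_smul, hb1, mul_one, Real.norm_eq_abs]
  rcases eq_or_eq_neg_of_abs_eq this with h | h
  · left; rw [← hcab, h, one_smul]
  · right; rw [← hcab, h, neg_one_smul]

lemma outerNormal_mem_orthogonal {n : ℕ} (T E : Finset (Pt n)) :
    outerNormal T E ∈ (vectorSpan ℝ (E : Set (Pt n)))ᗮ :=
  Submodule.smul_mem _ _ (Submodule.starProjection_apply_mem _ _)

variable {n : ℕ} {Ω : Set (Pt n)} {𝒯 : Triangulation Ω}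

namespace Triangulation

lemma mem_faces_of_mem_cells {T : Finset (Pt n)} (hT : T ∈ 𝒯.cells) : T ∈ 𝒯.faces := by
  simpa using (Finset.mem_filter.1 hT).1

lemma card_of_mem_cells {T : Finset (Pt n)} (hT : T ∈ 𝒯.cells) : T.card = n + 1 :=
  (Finset.mem_filter.1 hT).2

lemma mem_cells {T : Finset (Pt n)} (hT : T ∈ 𝒯.faces) (hc : T.card = n + 1) : T ∈ 𝒯.cells :=
  Finset.mem_filter.2 ⟨by simpa using hT, hc⟩

lemma mem_faces_of_mem_sides {E : Finset (Pt n)} (hE : E ∈ 𝒯.sides) : E ∈ 𝒯.faces := by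
  simpa using (Finset.mem_filter.1 hE).1

lemma card_of_mem_sides {E : Finset (Pt n)} (hE : E ∈ 𝒯.sides) : E.card = n :=
  (Finset.mem_filter.1 hE).2

lemma mem_sidesOf {T : 𝒯.Cell} {E : 𝒯.Side} : E ∈ 𝒯.sidesOf T ↔ E.1 ⊆ T.1 := by
  classical
  simp [sidesOf]

lemma exists_cell_of_mem_closure {x : Pt n} (hx : x ∈ closure Ω) :
    ∃ T : 𝒯.Cell, x ∈ hull T.1 := by
  rw [← 𝒯.space_eq, Geometry.SimplicialComplex.mem_space_iff] at hx
  obtain ⟨s, hs, hxs⟩ := hx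
  obtain ⟨T, hT, hsT, hc⟩ := 𝒯.pure_faces s hs
  exact ⟨⟨T, mem_cells hT hc⟩, convexHull_mono (by exact_mod_cast hsT) hxs⟩

lemma hull_subset_closure {s : Finset (Pt n)} (hs : s ∈ 𝒯.faces) : hull s ⊆ closure Ω := by
  rw [← 𝒯.space_eq]
  exact Geometry.SimplicialComplex.convexHull_subset_space hs

/-- A cell is locally a half space at the relative interior of its sides. -/
lemma exists_height (hn : 1 ≤ n) {T : 𝒯.Cell} {E : 𝒯.Side} (h : E ∈ 𝒯.sidesOf T) :
    ∃ l : Pt n →ₗ[ℝ] ℝ, (∀ v ∈ vectorSpan ℝ (E.1 : Set (Pt n)), l v = 0) ∧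
      l (outerNormal T.1 E.1) < 0 ∧ ‖outerNormal T.1 E.1‖ = 1 ∧
      ∀ x ∈ relInt E.1, ∀ᶠ y in 𝓝 x, (y ∈ hull T.1 ↔ 0 ≤ l (y - x)) := by
  obtain ⟨l, l0, lneg, hl⟩ := DPG.exists_height hn (𝒯.indep (mem_faces_of_mem_cells T.2))
    (card_of_mem_cells T.2) (mem_sidesOf.1 h) (card_of_mem_sides E.2)
  set w := (vectorSpan ℝ (E.1 : Set (Pt n)))ᗮ.starProjection (mid E.1 - mid T.1) with hw
  have hlw : l w < 0 := by
    have h1 : mid E.1 - mid T.1 - w ∈ vectorSpan ℝ (E.1 : Set (Pt n)) := by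
      have := Submodule.sub_starProjection_mem_orthogonal (K := (vectorSpan ℝ (E.1 : Set (Pt n)))ᗮ)
        (mid E.1 - mid T.1)
      rwa [Submodule.orthogonal_orthogonal] at this
    have := l0 _ h1
    rw [map_sub, sub_eq_zero] at this
    rwa [← this]
  have hw0 : w ≠ 0 := fun h => by simp [h] at hlw
  have hν : outerNormal T.1 E.1 = ‖w‖⁻¹ • w := rfl
  refine ⟨l, l0, ?_, ?_, hl⟩
  · rw [hν, map_smul, smul_eq_mul]
    exact mul_neg_of_pos_of_neg (by positivity) hlw
  · rw [hν, norm_smul, norm_inv, norm_norm, inv_mul_cancel₀ (norm_ne_zero_iff.2 hw0)]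

lemma tendsto_add_smul (x d : Pt n) :
    Tendsto (fun t : ℝ => x + t • d) (𝓝[>] 0) (𝓝 x) := by
  have : Continuous (fun t : ℝ => x + t • d) := by fun_prop
  simpa using (this.tendsto 0).mono_left nhdsWithin_le_nhds

lemma side_nonempty (hn : 1 ≤ n) (E : 𝒯.Side) : E.1.Nonempty :=
  Finset.card_pos.1 (by rw [card_of_mem_sides E.2]; omega)

lemma outerNormal_eq_or (hn : 1 ≤ n) {T T' : 𝒯.Cell} {E : 𝒯.Side} (h : E ∈ 𝒯.sidesOf T)
    (h' : E ∈ 𝒯.sidesOf T') : outerNormal T.1 E.1 = outerNormal T'.1 E.1 ∨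
      outerNormal T.1 E.1 = -outerNormal T'.1 E.1 := by
  obtain ⟨l, l0, lneg, hν, hl⟩ := exists_height hn h
  obtain ⟨l', l0', lneg', hν', hl'⟩ := exists_height hn h'
  exact eq_or_eq_neg_of_mem_orthogonal hn (𝒯.indep (mem_faces_of_mem_sides E.2))
    (card_of_mem_sides E.2) (outerNormal_mem_orthogonal _ _) (outerNormal_mem_orthogonal _ _) hν hν'

/-- Different cells lie on opposite sides of a common side. -/
lemma outerNormal_eq_neg (hn : 1 ≤ n) {T T' : 𝒯.Cell} {E : 𝒯.Side} (h : E ∈ 𝒯.sidesOf T)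
    (h' : E ∈ 𝒯.sidesOf T') (hne : T ≠ T') :
    outerNormal T.1 E.1 = -outerNormal T'.1 E.1 := by
  classical
  refine (outerNormal_eq_or hn h h').resolve_left fun heq => ?_
  obtain ⟨l, l0, lneg, hν, hl⟩ := exists_height hn h
  obtain ⟨l', l0', lneg', hν', hl'⟩ := exists_height hn h'
  have hx := mid_mem_relInt (side_nonempty hn E)
  -- If the normals agreed, a small step inwards from the midpoint would land in both cells. Their
  -- intersection is `hull E`, where the height `l` relative to the midpoint vanishes, although the
  -- step makes it positive.
  have hlim := tendsto_add_smul (mid E.1) (-outerNormal T.1 E.1)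
  obtain ⟨t, h1, h2, ht⟩ := ((hlim.eventually (hl _ hx)).and
    ((hlim.eventually (hl' _ hx)).and self_mem_nhdsWithin)).exists
  have ht : 0 < t := ht
  have hval : ∀ k : Pt n →ₗ[ℝ] ℝ, k (mid E.1 + t • -outerNormal T.1 E.1 - mid E.1) =
      -(t * k (outerNormal T.1 E.1)) := fun k => by simp
  rw [hval] at h1 h2
  have m1 := h1.2 (by nlinarith)
  have m2 := h2.2 (by rw [heq]; nlinarith)
  have hTT : T.1 ∩ T'.1 = E.1 := by
    have hsub : E.1 ⊆ T.1 ∩ T'.1 := Finset.subset_inter (mem_sidesOf.1 h) (mem_sidesOf.1 h')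
    refine (Finset.eq_of_subset_of_card_le hsub ?_).symm
    by_contra hlt
    rw [card_of_mem_sides E.2] at hlt
    have hTc := card_of_mem_cells T.2
    have hTc' := card_of_mem_cells T'.2
    have e1 : T.1 ∩ T'.1 = T.1 := Finset.eq_of_subset_of_card_le Finset.inter_subset_left (by omega)
    have e2 : T.1 ∩ T'.1 = T'.1 :=
      Finset.eq_of_subset_of_card_le Finset.inter_subset_right (by omega)
    exact hne (Subtype.ext (e1.symm.trans e2))
  have m3 := 𝒯.inter_subset_convexHull (mem_faces_of_mem_cells T.2) (mem_faces_of_mem_cells T'.2)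
    ⟨m1, m2⟩
  rw [← Finset.coe_inter, hTT] at m3
  have hm : mid E.1 ∈ affineSpan ℝ (E.1 : Set (Pt n)) :=
    convexHull_subset_affineSpan _ (relInt_subset_hull _ hx)
  have := vsub_mem_vectorSpan_of_mem_affineSpan_of_mem_affineSpan
    (convexHull_subset_affineSpan _ m3) hm
  have h0 := l0 _ this
  rw [vsub_eq_sub, hval] at h0
  nlinarith

/-- Every direction at an inner point of a side points into one of the adjacent cells. -/
lemma exists_cell_of_direction (hΩ : IsOpen Ω) {E : 𝒯.Side} {x : Pt n}
    (hx : x ∈ relInt E.1) (hxΩ : x ∈ Ω) (d : Pt n) :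
    ∃ T : 𝒯.Cell, E ∈ 𝒯.sidesOf T ∧ ∃ᶠ t : ℝ in 𝓝[>] 0, x + t • d ∈ hull T.1 := by
  classical
  have hlim := tendsto_add_smul x d
  have hex : ∃ T : 𝒯.Cell, ∃ᶠ t : ℝ in 𝓝[>] 0, x + t • d ∈ hull T.1 := by
    -- Pigeonhole: near `x` the ray stays in `Ω`, which finitely many cells cover.
    by_contra! hcon
    obtain ⟨t, h1, h2⟩ := ((hlim.eventually (hΩ.mem_nhds hxΩ)).and (eventually_all.2 hcon)).exists
    obtain ⟨T, hT⟩ := 𝒯.exists_cell_of_mem_closure (subset_closure h1)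
    exact h2 T hT
  obtain ⟨T, hT⟩ := hex
  refine ⟨T, mem_sidesOf.2 ?_, hT⟩
  have hxT : x ∈ hull T.1 := by
    rw [← (isCompact_hull T.1).isClosed.closure_eq]
    exact mem_closure_of_frequently_of_tendsto hT hlim
  have := 𝒯.inter_subset_convexHull (mem_faces_of_mem_sides E.2) (mem_faces_of_mem_cells T.2)
    ⟨relInt_subset_hull _ hx, hxT⟩
  rw [← Finset.coe_inter] at this
  obtain ⟨S, hS, hES, hSc⟩ := 𝒯.pure_faces _ (mem_faces_of_mem_sides E.2)
  exact (subset_of_relInt_of_mem_hull (𝒯.indep hS) hSc hES Finset.inter_subset_left hx this).trans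
    Finset.inter_subset_right

/-- A point of `E` off the frontier may lie on a lower-dimensional face; openness of `Ω` and density
of `relInt` allow it to be moved. -/
lemma exists_mem_relInt_of_isInteriorSide (hn : 1 ≤ n) (hΩ : IsOpen Ω) {E : 𝒯.Side}
    (hE : 𝒯.IsInteriorSide E) : ∃ x ∈ relInt E.1, x ∈ Ω := by
  obtain ⟨y, hy, hyf⟩ := Set.not_subset.1 hE
  have hyΩ : y ∈ Ω := by
    have := hull_subset_closure (mem_faces_of_mem_sides E.2) hy
    rw [hΩ.frontier_eq] at hyf
    by_contra h
    exact hyf ⟨this, h⟩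
  obtain ⟨x, hxΩ, hx⟩ := mem_closure_iff.1 (hull_subset_closure_relInt (side_nonempty hn E) hy) Ω hΩ
    hyΩ
  exact ⟨x, hx, hxΩ⟩

/-- An interior side has a cell on the side that a given adjacent cell does not occupy. -/
lemma exists_opposite_cell (hn : 1 ≤ n) (hΩ : IsOpen Ω) {T : 𝒯.Cell} {E : 𝒯.Side}
    (hE : 𝒯.IsInteriorSide E) (h : E ∈ 𝒯.sidesOf T) : ∃ T' : 𝒯.Cell, E ∈ 𝒯.sidesOf T' ∧ T' ≠ T := by
  obtain ⟨x, hx, hxΩ⟩ := exists_mem_relInt_of_isInteriorSide hn hΩ hE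
  -- The outer normal of `T` leaves `T` at once, so the cell it enters is another one.
  obtain ⟨T', hT', hfr⟩ := exists_cell_of_direction hΩ hx hxΩ (outerNormal T.1 E.1)
  refine ⟨T', hT', ?_⟩
  rintro rfl
  obtain ⟨l, l0, lneg, hν, hl⟩ := exists_height hn h
  have hlim := tendsto_add_smul x (outerNormal T'.1 E.1)
  obtain ⟨t, h1, h2, ht⟩ := (hfr.and_eventually
    ((hlim.eventually (hl _ hx)).and self_mem_nhdsWithin)).exists
  have ht : 0 < t := ht
  have := h2.1 h1
  rw [add_sub_cancel_left, map_smul, smul_eq_mul] at this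
  nlinarith

/-- A boundary side belongs to only one cell. -/
lemma cell_unique_of_isBoundarySide (hn : 1 ≤ n) (hΩ : IsLipschitzDomain Ω) {T T' : 𝒯.Cell}
    {E : 𝒯.Side} (hE : 𝒯.IsBoundarySide E) (h : E ∈ 𝒯.sidesOf T) (h' : E ∈ 𝒯.sidesOf T') :
    T = T' := by
  by_contra hne
  obtain ⟨l, l0, lneg, hν, hl⟩ := exists_height hn h
  obtain ⟨l', l0', lneg', hν', hl'⟩ := exists_height hn h'
  have hopp := outerNormal_eq_neg hn h h' hne
  have hx := mid_mem_relInt (side_nonempty hn E)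
  have hxf := hE (relInt_subset_hull _ hx)
  -- Near the midpoint the two cells are complementary half spaces, so together they fill a
  -- neighbourhood. Both heights see only the normal component of `y - mid E`, whose sign selects
  -- the cell.
  have hint : mid E.1 ∈ interior (closure Ω) := by
    rw [mem_interior_iff_mem_nhds]
    filter_upwards [hl _ hx, hl' _ hx] with y hy hy'
    set a := outerNormal T.1 E.1
    set b := outerNormal T'.1 E.1
    have hdecomp : y - mid E.1 - inner ℝ a (y - mid E.1) • a ∈
        vectorSpan ℝ (E.1 : Set (Pt n)) := by
      have hw : y - mid E.1 - inner ℝ a (y - mid E.1) • a ∈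
          (vectorSpan ℝ (E.1 : Set (Pt n)))ᗮᗮ := by
        rw [Submodule.mem_orthogonal]
        intro d hd
        have key : ∀ d ∈ (vectorSpan ℝ (E.1 : Set (Pt n)))ᗮ, ‖d‖ = 1 →
            inner ℝ d (y - mid E.1 - inner ℝ a (y - mid E.1) • a) = 0 := by
          intro d hd hd1
          have ha : inner ℝ a a = (1 : ℝ) := by rw [real_inner_self_eq_norm_sq, hν]; norm_num
          rcases eq_or_eq_neg_of_mem_orthogonal hn (𝒯.indep (mem_faces_of_mem_sides E.2))
            (card_of_mem_sides E.2) hd (outerNormal_mem_orthogonal T.1 E.1) hd1 hν with rfl | rfl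
          · rw [inner_sub_right, inner_smul_right, ha]; ring
          · rw [inner_neg_left, inner_sub_right, inner_smul_right, ha]; ring
        rcases eq_or_ne d 0 with rfl | hd0
        · simp
        have := key (‖d‖⁻¹ • d) (Submodule.smul_mem _ _ hd)
          (by rw [norm_smul, norm_inv, norm_norm, inv_mul_cancel₀ (norm_ne_zero_iff.2 hd0)])
        rw [inner_smul_left] at this
        rcases mul_eq_zero.1 this with h0 | h0
        · simp [hd0] at h0
        · exact h0
      rwa [Submodule.orthogonal_orthogonal] at hw
    have e1 := l0 _ hdecomp
    have e2 := l0' _ hdecomp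
    rw [map_sub, map_smul, smul_eq_mul, sub_eq_zero] at e1 e2
    rw [e1] at hy
    rw [e2, hopp, map_neg] at hy'
    rcases le_total (inner ℝ a (y - mid E.1)) 0 with hs | hs
    · exact hull_subset_closure (mem_faces_of_mem_cells T.2) (hy.2 (by nlinarith))
    · refine hull_subset_closure (mem_faces_of_mem_cells T'.2) (hy'.2 ?_)
      rw [← hopp]
      nlinarith
  rw [hΩ.isOpen.frontier_eq] at hxf
  exact hxf.2 (hΩ.interior_closure_subset hint)

end Triangulation

/-! ### Jumps -/

open Classical in
/-- The signed sum, over the cells with side `E`, of the traces at the midpoint of `E`. -/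
def jump (ν : 𝒯.Side → Pt n) (E : 𝒯.Side) : P1 𝒯 →ₗ[ℝ] ℝ where
  toFun v := ∑ T : 𝒯.Cell with E ∈ 𝒯.sidesOf T, inner ℝ (outerNormal T.1 E.1) (ν E) * v T (mid E.1)
  map_add' v w := by simp [mul_add, Finset.sum_add_distrib]
  map_smul' r v := by simp [Finset.mul_sum, mul_left_comm]

open Classical in
lemma jump_apply (ν : 𝒯.Side → Pt n) (E : 𝒯.Side) (v : P1 𝒯) :
    jump ν E v = ∑ T : 𝒯.Cell with E ∈ 𝒯.sidesOf T,
      inner ℝ (outerNormal T.1 E.1) (ν E) * v T (mid E.1) := rfl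

lemma norm_outerNormal (hn : 1 ≤ n) {T : 𝒯.Cell} {E : 𝒯.Side} (h : E ∈ 𝒯.sidesOf T) :
    ‖outerNormal T.1 E.1‖ = 1 :=
  (Triangulation.exists_height hn h).choose_spec.2.2.1

lemma inner_outerNormal_self (hn : 1 ≤ n) {T : 𝒯.Cell} {E : 𝒯.Side} (h : E ∈ 𝒯.sidesOf T) :
    inner ℝ (outerNormal T.1 E.1) (outerNormal T.1 E.1) = (1 : ℝ) := by
  rw [real_inner_self_eq_norm_sq, norm_outerNormal hn h]; norm_num

lemma jump_of_isBoundarySide (hn : 1 ≤ n) (hΩ : IsLipschitzDomain Ω) {ν : 𝒯.Side → Pt n}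
    (hν : 𝒯.IsOrientation ν) {E : 𝒯.Side} (hE : 𝒯.IsBoundarySide E) {T : 𝒯.Cell}
    (h : E ∈ 𝒯.sidesOf T) (v : P1 𝒯) : jump ν E v = v T (mid E.1) := by
  classical
  obtain ⟨T₀, h₀, hT₀⟩ := hν E
  obtain rfl := 𝒯.cell_unique_of_isBoundarySide hn hΩ hE h h₀
  rw [jump_apply, Finset.sum_eq_single_of_mem T (by simpa using h), hT₀,
    inner_outerNormal_self hn h, one_mul]
  intro T' hT' hne
  exact absurd (𝒯.cell_unique_of_isBoundarySide hn hΩ hE (by simpa using hT') h) hne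

lemma exists_jump_of_isInteriorSide (hn : 1 ≤ n) (hΩ : IsLipschitzDomain Ω)
    {ν : 𝒯.Side → Pt n} (hν : 𝒯.IsOrientation ν) {E : 𝒯.Side} (hE : 𝒯.IsInteriorSide E) :
    ∃ T₁ T₂ : 𝒯.Cell, E ∈ 𝒯.sidesOf T₁ ∧ E ∈ 𝒯.sidesOf T₂ ∧
      (∀ T, E ∈ 𝒯.sidesOf T → T = T₁ ∨ T = T₂) ∧
      ∀ v : P1 𝒯, jump ν E v = v T₁ (mid E.1) - v T₂ (mid E.1) := by
  classical
  obtain ⟨T₁, h₁, hT₁⟩ := hν E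
  obtain ⟨T₂, h₂, hne⟩ := 𝒯.exists_opposite_cell hn hΩ.isOpen hE h₁
  have huniq : ∀ T, E ∈ 𝒯.sidesOf T → T = T₁ ∨ T = T₂ := by
    -- Three unit normals cannot be pairwise opposite.
    intro T h
    by_contra! hT
    have e1 := Triangulation.outerNormal_eq_neg hn h h₁ hT.1
    have e2 := Triangulation.outerNormal_eq_neg hn h h₂ hT.2
    have e3 := Triangulation.outerNormal_eq_neg hn h₂ h₁ hne
    rw [e1, e3, neg_neg] at e2
    have := congrArg (inner ℝ (outerNormal T₁.1 E.1)) e2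
    rw [inner_neg_right, inner_outerNormal_self hn h₁] at this
    norm_num at this
  have hfilter : (Finset.univ.filter fun T : 𝒯.Cell => E ∈ 𝒯.sidesOf T) = {T₁, T₂} := by
    ext T
    simp only [Finset.mem_filter, Finset.mem_univ, true_and, Finset.mem_insert,
      Finset.mem_singleton]
    exact ⟨huniq T, by rintro (rfl | rfl) <;> assumption⟩
  refine ⟨T₁, T₂, h₁, h₂, huniq, fun v => ?_⟩
  rw [jump_apply, hfilter, Finset.sum_pair hne.symm, hT₁,
    Triangulation.outerNormal_eq_neg hn h₂ h₁ hne, inner_neg_left, inner_outerNormal_self hn h₁]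
  ring

lemma mem_CR10_iff_jump (hn : 1 ≤ n) (hΩ : IsLipschitzDomain Ω) {ν : 𝒯.Side → Pt n}
    (hν : 𝒯.IsOrientation ν) (v : P1 𝒯) : v ∈ CR10 𝒯 ↔ ∀ E, jump ν E v = 0 := by
  constructor
  · rintro ⟨hint, hbd⟩ E
    by_cases hE : 𝒯.IsBoundarySide E
    · obtain ⟨T, h, -⟩ := hν E
      rw [jump_of_isBoundarySide hn hΩ hν hE h, hbd E hE T h]
    · obtain ⟨T₁, T₂, h₁, h₂, -, hj⟩ := exists_jump_of_isInteriorSide hn hΩ hν hE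
      rw [hj, hint E hE T₁ T₂ h₁ h₂, sub_self]
  · intro hv
    refine ⟨fun E hE T T' h h' => ?_, fun E hE T h => ?_⟩
    · obtain ⟨T₁, T₂, h₁, h₂, hu, hj⟩ := exists_jump_of_isInteriorSide hn hΩ hν hE
      have h12 : v T₁ (mid E.1) = v T₂ (mid E.1) := sub_eq_zero.1 ((hj v).symm.trans (hv E))
      rcases hu T h with rfl | rfl <;> rcases hu T' h' with rfl | rfl <;> simp [h12]
    · rw [← jump_of_isBoundarySide hn hΩ hν hE h, hv E]

/-- The bracket is a weighted sum of the jumps. -/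
lemma exists_bracket_eq_sum_jump (hn : 1 ≤ n) (ν : 𝒯.Side → Pt n) :
    ∃ c : 𝒯.Side → ℝ, (∀ E, 0 < c E) ∧
      ∀ t v, bracket ν t v = ∑ E, t E * c E * jump ν E v := by
  classical
  choose c hc hint using fun E : 𝒯.Side => exists_integral_side hn
    (𝒯.indep (Triangulation.mem_faces_of_mem_sides E.2)) (Triangulation.card_of_mem_sides E.2)
  refine ⟨c, hc, fun t v => ?_⟩
  have h1 : ∀ (T : 𝒯.Cell) (E : 𝒯.Side),
      ∫ x in hull E.1, localTrace ν t T E * v T x ∂(μHE[n - 1] : Measure (Pt n)) =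
        t E * c E * (inner ℝ (outerNormal T.1 E.1) (ν E) * v T (mid E.1)) := by
    intro T E
    rw [integral_const_mul, hint E, localTrace]
    ring
  simp_rw [bracket, h1, jump_apply, Finset.mul_sum]
  rw [Finset.sum_comm' (t' := Finset.univ)
    (s' := fun E => Finset.univ.filter fun T : 𝒯.Cell => E ∈ 𝒯.sidesOf T)]
  simp

/-- The jumps are linearly independent: there is a dual basis. -/
lemma exists_jump_eq_single (hn : 1 ≤ n) {ν : 𝒯.Side → Pt n}
    (hν : 𝒯.IsOrientation ν) (E : 𝒯.Side) :
    ∃ v : P1 𝒯, jump ν E v = 1 ∧ ∀ F, F ≠ E → jump ν F v = 0 := by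
  classical
  obtain ⟨T, h, hT⟩ := hν E
  obtain ⟨A, hA1, hA0⟩ := exists_affine_mid_eq_one hn
    (𝒯.indep (Triangulation.mem_faces_of_mem_cells T.2)) (Triangulation.card_of_mem_cells T.2)
    (Triangulation.mem_sidesOf.1 h) (Triangulation.card_of_mem_sides E.2)
  -- The nodal function of `E` on a single cell, extended by zero; `T` is the cell that defines `ν
  -- E`, so the sign is `+1`.
  refine ⟨Pi.single T A, ?_, fun F hF => ?_⟩
  · rw [jump_apply, Finset.sum_eq_single_of_mem T (by simpa using h), hT,
      inner_outerNormal_self hn h, Pi.single_eq_same, hA1, one_mul]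
    intro T' _ hne
    simp [Pi.single_eq_of_ne hne]
  · rw [jump_apply]
    refine Finset.sum_eq_zero fun T' hT' => ?_
    rcases eq_or_ne T' T with rfl | hne
    · rw [Pi.single_eq_same, hA0 F.1 (Triangulation.mem_sidesOf.1 (by simpa using hT'))
        (Triangulation.card_of_mem_sides F.2) (fun h => hF (Subtype.ext h)), mul_zero]
    · simp [Pi.single_eq_of_ne hne]

/-! ### Linearity of the forms -/

lemma P1.toFun_add (v w : P1 𝒯) (x : Pt n) :
    P1.toFun (v + w) x = v.toFun x + w.toFun x := by
  simp only [P1.toFun, ← Finset.sum_add_distrib]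
  refine Finset.sum_congr rfl fun T _ => ?_
  by_cases h : x ∈ interior (hull T.1) <;> simp [h]

lemma P1.toFun_smul (r : ℝ) (v : P1 𝒯) (x : Pt n) :
    P1.toFun (r • v) x = r * v.toFun x := by
  simp only [P1.toFun, Finset.mul_sum]
  refine Finset.sum_congr rfl fun T _ => ?_
  by_cases h : x ∈ interior (hull T.1) <;> simp [h]

lemma hasGradientAt_affineMap (A : Pt n →ᵃ[ℝ] ℝ) (x : Pt n) :
    HasGradientAt (fun z => A z)
      ((InnerProductSpace.toDual ℝ (Pt n)).symm (LinearMap.toContinuousLinearMap A.linear)) x := by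
  rw [hasGradientAt_iff_hasFDerivAt, LinearIsometryEquiv.apply_symm_apply]
  have h : (fun z => A z) = fun z => LinearMap.toContinuousLinearMap A.linear z + A 0 := by
    ext z
    exact congrFun A.decomp z
  rw [h]
  exact (ContinuousLinearMap.hasFDerivAt _).add_const _

lemma gradient_affineMap (A : Pt n →ᵃ[ℝ] ℝ) (x : Pt n) :
    gradient (fun z => A z) x =
      (InnerProductSpace.toDual ℝ (Pt n)).symm (LinearMap.toContinuousLinearMap A.linear) :=
  (hasGradientAt_affineMap A x).gradient

lemma P1.gradNC_add (v w : P1 𝒯) (x : Pt n) :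
    P1.gradNC (v + w) x = v.gradNC x + w.gradNC x := by
  simp only [P1.gradNC, ← Finset.sum_add_distrib]
  refine Finset.sum_congr rfl fun T _ => ?_
  by_cases h : x ∈ interior (hull T.1)
  · simp only [Set.indicator_of_mem h, gradient_affineMap, Pi.add_apply, AffineMap.add_linear,
      map_add]
  · simp [h]

lemma P1.gradNC_smul (r : ℝ) (v : P1 𝒯) (x : Pt n) :
    P1.gradNC (r • v) x = r • v.gradNC x := by
  simp only [P1.gradNC, Finset.smul_sum]
  refine Finset.sum_congr rfl fun T _ => ?_
  by_cases h : x ∈ interior (hull T.1)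
  · simp only [Set.indicator_of_mem h, gradient_affineMap, Pi.smul_apply, AffineMap.smul_linear,
      map_smul]
  · simp [h]

lemma P1.toFun_zero (x : Pt n) : P1.toFun (0 : P1 𝒯) x = 0 := by
  simpa using P1.toFun_smul (0 : ℝ) (0 : P1 𝒯) x

lemma P1.gradNC_zero (x : Pt n) : P1.gradNC (0 : P1 𝒯) x = 0 := by
  simpa using P1.gradNC_smul (0 : ℝ) (0 : P1 𝒯) x

lemma zero_mem_S10 : (0 : P1 𝒯) ∈ S10 𝒯 := by
  have h0 : P1.toFun (0 : P1 𝒯) = 0 := funext P1.toFun_zero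
  have hg : gradient (0 : Pt n → ℝ) = 0 := by
    ext1 x
    simp [gradient]
  change MemH10 Ω (P1.toFun (0 : P1 𝒯))
  rw [h0]
  refine ⟨MemLp.zero, 0, MemLp.zero, fun _ => 0, fun _ => ⟨contDiff_const, ?_, ?_⟩, ?_, ?_⟩
  · exact HasCompactSupport.zero
  · simp
  · simp
  · simp [hg]

/-- Finite sums of continuous functions cut off to the cells are bounded and measurable. -/
lemma memLp_top_sum_indicator {F : Type*} [NormedAddCommGroup F]
    {g : 𝒯.Cell → Pt n → F} (hg : ∀ T, Continuous (g T)) :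
    MemLp (fun x => ∑ T : 𝒯.Cell, (interior (hull T.1)).indicator (g T) x) ⊤
      (volume.restrict Ω) := by
  refine memLp_finsetSum _ fun T _ => ?_
  obtain ⟨C, hC⟩ := (isCompact_hull T.1).exists_bound_of_continuousOn (hg T).continuousOn
  refine memLp_top_of_bound
    (((hg T).aestronglyMeasurable).indicator isOpen_interior.measurableSet) (max C 0)
    (ae_of_all _ fun x => ?_)
  by_cases hx : x ∈ interior (hull T.1)
  · rw [Set.indicator_of_mem hx]
    exact (hC x (interior_subset hx)).trans (le_max_left _ _)
  · rw [Set.indicator_of_notMem hx]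
    simp

lemma P1.memLp_toFun (v : P1 𝒯) :
    MemLp v.toFun ⊤ (volume.restrict Ω) :=
  memLp_top_sum_indicator fun T => (v T).continuous_of_finiteDimensional

lemma P1.memLp_gradNC (v : P1 𝒯) :
    MemLp v.gradNC ⊤ (volume.restrict Ω) := by
  refine memLp_top_sum_indicator fun T => ?_
  simp_rw [gradient_affineMap]
  exact continuous_const

lemma integrable_inner_of_top {α F : Type*} [MeasurableSpace α] {μ : Measure α}
    [NormedAddCommGroup F] [InnerProductSpace ℝ F] {g h : α → F} (hg : Integrable g μ)
    (hh : MemLp h ⊤ μ) : Integrable (fun x => inner ℝ (g x) (h x)) μ := by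
  refine Integrable.mono (hg.norm.smul_of_top_left hh.norm)
    (hg.aestronglyMeasurable.inner hh.aestronglyMeasurable) (ae_of_all _ fun x => ?_)
  refine (norm_inner_le_norm _ _).trans ?_
  simp

/-- The residual of the first equation of the reduced system. -/
def residual (φ : ℝ → ℝ) (f : Pt n → ℝ) (u v η : P1 𝒯) : ℝ :=
  aForm v η + (∫ x in Ω, inner ℝ (sigma φ (u.gradNC x)) (η.gradNC x)) - load f η

/-- Linearity in the test function needs every integrand to be integrable: `σ(∇u)` is bounded
because `φ` is, and `Ω` has finite measure, so `f` is integrable too. -/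
lemma isLinearMap_residual (hΩ : IsLipschitzDomain Ω) {φ : ℝ → ℝ} {γ : ℝ}
    (hφc : ContinuousOn φ (Set.Ici 0)) (hφ : ∀ t, 0 ≤ t → |φ t| ≤ γ) {f : Pt n → ℝ}
    (hf : MemLp f 2 (volume.restrict Ω)) (u v : P1 𝒯) :
    IsLinearMap ℝ (residual φ f u v) := by
  have : IsFiniteMeasure (volume.restrict Ω) :=
    ⟨by simpa using hΩ.isBounded.measure_lt_top⟩
  have hσ : MemLp (fun x => sigma φ (u.gradNC x)) ⊤ (volume.restrict Ω) := by
    have hcont : Continuous (sigma φ : Pt n → Pt n) :=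
      (hφc.comp_continuous continuous_norm fun A => norm_nonneg A).smul continuous_id
    have hu := u.memLp_gradNC
    refine MemLp.of_le_mul (c := γ) hu
      (hcont.comp_aestronglyMeasurable hu.aestronglyMeasurable) (ae_of_all _ fun x => ?_)
    rw [sigma, norm_smul]
    exact mul_le_mul_of_nonneg_right (hφ _ (norm_nonneg _)) (norm_nonneg _)
  have hv := v.memLp_toFun
  have i1 : ∀ η : P1 𝒯, Integrable (fun x => v.toFun x * η.toFun x) (volume.restrict Ω) :=
    fun η => by
      simpa [mul_comm] using integrable_inner_of_top (hv.integrable le_top) η.memLp_toFun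
  have i2 : ∀ η : P1 𝒯, Integrable (fun x => inner ℝ (v.gradNC x) (η.gradNC x))
      (volume.restrict Ω) := fun η =>
    integrable_inner_of_top (v.memLp_gradNC.integrable le_top) η.memLp_gradNC
  have i3 : ∀ η : P1 𝒯, Integrable (fun x => inner ℝ (sigma φ (u.gradNC x)) (η.gradNC x))
      (volume.restrict Ω) := fun η =>
    integrable_inner_of_top (hσ.integrable le_top) η.memLp_gradNC
  have i4 : ∀ η : P1 𝒯, Integrable (fun x => f x * η.toFun x) (volume.restrict Ω) :=
    fun η => by
      simpa [mul_comm] using integrable_inner_of_top (hf.integrable (by norm_num))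
        η.memLp_toFun
  constructor
  · intro η ζ
    simp only [residual, aForm, load, P1.toFun_add, P1.gradNC_add, mul_add, inner_add_right]
    rw [integral_add (i1 η) (i1 ζ), integral_add (i2 η) (i2 ζ), integral_add (i3 η) (i3 ζ),
      integral_add (i4 η) (i4 ζ)]
    ring
  · intro r η
    simp only [residual, aForm, load, P1.toFun_smul, P1.gradNC_smul, inner_smul_right,
      mul_left_comm _ r, integral_const_mul, smul_eq_mul]
    ring

lemma dsigmaForm_zero (φ : ℝ → ℝ) (u v : P1 𝒯) : dsigmaForm φ u 0 v = 0 := by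
  simp [dsigmaForm, P1.gradNC_zero]

lemma residual_eq_bracket_iff (φ : ℝ → ℝ) (f : Pt n → ℝ) (ν : 𝒯.Side → Pt n) (u v η : P1 𝒯)
    (t : P0Sides 𝒯) :
    aForm v η + bForm φ ν u t η = load f η ↔ residual φ f u v η = bracket ν t η := by
  rw [bForm, residual]
  constructor <;> intro h <;> linarith

end DPG

end

/-! ### Equivalence of the mixed and the reduced system -/

theorem theorem5 {n : ℕ} (hn : 1 ≤ n) {Ω : Set (DPG.Pt n)} (hΩ : DPG.IsLipschitzDomain Ω)
    (𝒯 : DPG.Triangulation Ω) (ν : 𝒯.Side → DPG.Pt n) (hν : 𝒯.IsOrientation ν)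
    (φ : ℝ → ℝ) (γ₁ γ₂ : ℝ) (hγ₁ : 0 < γ₁)
    (hφ_cont : ContinuousOn φ (Set.Ici 0)) (hφ_diff : ContDiffOn ℝ 2 φ (Set.Ioi 0))
    (hφ : ∀ t : ℝ, 0 ≤ t → γ₁ ≤ φ t ∧ φ t ≤ γ₂)
    (hφ' : ∀ t : ℝ, 0 < t → γ₁ ≤ φ t + t * deriv φ t ∧ φ t + t * deriv φ t ≤ γ₂)
    (f : DPG.Pt n → ℝ) (hf : MemLp f 2 (volume.restrict Ω)) :
    (∀ (u v : DPG.P1 𝒯) (t : DPG.P0Sides 𝒯), DPG.SolvesMixed φ f ν u t v →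
      v ∈ DPG.CR10 𝒯 ∧ DPG.SolvesReduced φ f u v) ∧
    (∀ u v : DPG.P1 𝒯, DPG.SolvesReduced φ f u v →
      ∃! t : DPG.P0Sides 𝒯, DPG.SolvesMixed φ f ν u t v) := by
  classical
  obtain ⟨c, hc, hbr⟩ := DPG.exists_bracket_eq_sum_jump (𝒯 := 𝒯) hn ν
  have hCR : ∀ w : DPG.P1 𝒯, w ∈ DPG.CR10 𝒯 → ∀ s, DPG.bracket ν s w = 0 := by
    intro w hw s
    rw [hbr]
    exact Finset.sum_eq_zero fun E _ => by
      rw [(DPG.mem_CR10_iff_jump hn hΩ hν w).1 hw E, mul_zero]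
  refine ⟨fun u v t ⟨hu, h1, h2⟩ => ?_, fun u v ⟨hu, hv, h1, h2⟩ => ?_⟩
  · have hv : v ∈ DPG.CR10 𝒯 := by
      rw [DPG.mem_CR10_iff_jump hn hΩ hν]
      intro E
      -- This test pair isolates `c E * jump ν E v`.
      have := h2 0 DPG.zero_mem_S10 (Pi.single E 1)
      rw [DPG.bDeriv, DPG.dsigmaForm_zero, zero_sub, neg_eq_zero, hbr,
        Finset.sum_eq_single_of_mem E (Finset.mem_univ E)] at this
      · simpa [(hc E).ne'] using this
      · intro F _ hF
        simp [Pi.single_eq_of_ne hF]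
    refine ⟨hv, hu, hv, fun w hw => ?_, fun w hw => ?_⟩
    · have := h1 w
      rwa [DPG.bForm, hCR w hw, sub_zero] at this
    · have := h2 w hw 0
      rwa [DPG.bDeriv, hCR v hv, sub_zero] at this
  · have hlin := DPG.isLinearMap_residual hΩ hφ_cont (γ := γ₂)
      (fun t ht => abs_le.2 ⟨by linarith [hφ t ht], (hφ t ht).2⟩) hf u v
    have hspan : hlin.mk' _ ∈ Submodule.span ℝ (Set.range (DPG.jump ν)) := by
      -- A functional that vanishes on the common kernel of finitely many others lies in their span;
      -- here that kernel is `CR10 𝒯`.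
      refine mem_span_of_iInf_ker_le_ker fun w hw => ?_
      have hw' : w ∈ DPG.CR10 𝒯 :=
        (DPG.mem_CR10_iff_jump hn hΩ hν w).2 fun E => (Submodule.mem_iInf _).1 hw E
      exact sub_eq_zero.2 (h1 w hw')
    obtain ⟨d, hd⟩ := (Submodule.mem_span_range_iff_exists_fun ℝ).1 hspan
    have hd' : ∀ w, DPG.residual φ f u v w = ∑ E, d E * DPG.jump ν E w := by
      intro w
      have := LinearMap.congr_fun hd w
      simpa using this.symm
    refine ⟨fun E => d E / c E, ⟨hu, fun η => ?_, fun w hw s => ?_⟩, fun t ⟨_, ht, _⟩ => ?_⟩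
    · rw [DPG.residual_eq_bracket_iff, hd', hbr]
      exact Finset.sum_congr rfl fun E _ => by rw [div_mul_cancel₀ _ (hc E).ne']
    · rw [DPG.bDeriv, hCR v hv, sub_zero, h2 w hw]
    · ext1 E
      -- Testing with the dual basis function of `E` reads off `d E = t E * c E`.
      obtain ⟨w, hw1, hw0⟩ := DPG.exists_jump_eq_single hn hν E
      have := (DPG.residual_eq_bracket_iff φ f ν u v w t).1 (ht w)
      rw [hd', hbr, Finset.sum_eq_single_of_mem E (Finset.mem_univ E),
        Finset.sum_eq_single_of_mem E (Finset.mem_univ E), hw1, mul_one, mul_one] at this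
      · rw [this, mul_div_cancel_right₀ _ (hc E).ne']
      · intro F _ hF
        rw [hw0 F hF, mul_zero]
      · intro F _ hF
        rw [hw0 F hF, mul_zero]
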